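/- For a prime $q$ and integers $k, r\ge 1$ let $\mathrm{GIP}^k_{q,r}:(\mathbb F_q^r)^k\to\mathbb F_q$ be the generalized inner product $$\mathrm{GIP}^k_{q,r}(x_1,\dots,x_k)=\sum_{j=1}^{r}\prod_{i=1}^{k}x_{i,j},$$ and let $G(x_1,\dots,x_k)=\mathrm{GIP}^k_{q,r}(x_1,\dots,x_k)\bmod 2\in\{0,1\}$, where elements of $\mathbb F_q$ are identified with the integers $0,\dots,q-1$. In the $k$-party number-on-forehead (NOF) model, player $i$ sees all inputs except $x_i$ and the players write bits on a common blackboard. A randomized (public-coin) protocol is a probability distribution on deterministic NOF protocols, its cost is the maximal number of bits written, and the randomized NOF complexity of $G$ is the least cost of a randomized protocol that outputs the value of $G$ with error probability at most $1/3$ on every input (and $\infty$ if there is none). **Corollary.** There is an absolute constant $c>0$ such that the following holds for all integers $n\ge 1$ and $k\ge 1$ with $k\le\log_2 n-5\log_2\log_2 n$. Let $r=2^{k+1}$ and let $q$ be a prime whose binary representation has exactly $\lfloor n/2^{k+1}\rfloor$ bits. Then 1. the input $x_i\in\mathbb F_q^r$ of each player, with every coordinate written with the least number of bits that distinguishes the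 elements of $\mathbb F_q$, has length $n$ if $2^{k+1}$ divides $n$, and in general a length in the interval $(n-2^{k+1},\,n]$; 2. the randomized $k$-party NOF complexity of $G$ is at least $c\cdot n/2^{k+1}$. -/

import Mathlib

open scoped ENNReal

/-- A deterministic `k`-party number-on-forehead protocol with Boolean output, as a protocol tree.
At an inner node some player `i` writes one bit on the blackboard; this bit is an arbitrary function
of all inputs except the `i`-th one (and of the blackboard, i.e. of the node). The execution
continues in the first subtree if the bit is `false` and in the second one if it is `true`.
A leaf carries the output. -/
inductive NOFProtocol {k : ℕ} (X : Fin k → Type) : Type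
  | leaf (out : Bool) : NOFProtocol X
  | node (i : Fin k) (bit : ((j : {j : Fin k // j ≠ i}) → X j) → Bool)
      (onFalse onTrue : NOFProtocol X) : NOFProtocol X

namespace NOFProtocol

variable {k : ℕ} {X : Fin k → Type}

/-- The output of the protocol on the input `x`. -/
def eval : NOFProtocol X → ((j : Fin k) → X j) → Bool
  | leaf out, _ => out
  | node _ bit onFalse onTrue, x =>
      if bit (fun j => x j) then onTrue.eval x else onFalse.eval x

/-- The communication cost: the largest number of bits written, i.e. the depth of the tree. -/
def cost : NOFProtocol X → ℕ
  | leaf _ => 0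
  | node _ _ onFalse onTrue => max onFalse.cost onTrue.cost + 1

end NOFProtocol

/-- `f` has a public-coin randomized NOF protocol (a probability distribution `μ` on deterministic
NOF protocols) that never writes more than `c` bits and that errs with probability at most `1/3`
on every input. There are only countably many protocols if the sets `X i` are finite, so that
discrete distributions are then no restriction. -/
def HasRandomizedNOFCost {k : ℕ} {X : Fin k → Type} (f : ((j : Fin k) → X j) → Bool) (c : ℕ) :
    Prop :=
  ∃ μ : PMF (NOFProtocol X), (∀ P ∈ μ.support, P.cost ≤ c) ∧
    ∀ x, μ.toOuterMeasure {P | P.eval x ≠ f x} ≤ 1 / 3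

/-- The randomized NOF communication complexity (public coins, error `1/3`) of `f`;
it is `⊤` if no protocol computes `f`, as for a non-constant `f` and `k = 1`, where the only player
sees no input. -/
noncomputable def randomizedNOFComplexity {k : ℕ} {X : Fin k → Type}
    (f : ((j : Fin k) → X j) → Bool) : ℕ∞ :=
  ⨅ (c : ℕ) (_ : HasRandomizedNOFCost f c), (c : ℕ∞)

/-- The generalized inner product `∑ⱼ ∏ᵢ x_{i,j}` of `k` vectors in `𝔽_q ^ r`. -/
def GIP (q r k : ℕ) (x : Fin k → Fin r → ZMod q) : ZMod q :=
  ∑ j : Fin r, ∏ i : Fin k, x i j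

/-- `GIP mod 2`: the parity of the representative of `GIP` in `{0, …, q - 1}`. -/
def GIPMod2 (q r k : ℕ) (x : Fin k → Fin r → ZMod q) : Bool :=
  decide ((GIP q r k x).val % 2 = 1)

/-- The number of bits of the input `x_i ∈ 𝔽_q ^ r` of one player, where each of the `r` coordinates
is written with the least number of bits that suffices to tell the elements of `𝔽_q` apart. -/
noncomputable def GIPInputLength (q r : ℕ) : ℕ :=
  r * Nat.clog 2 (Nat.card (ZMod q))

/-! This is the discrepancy method. A protocol of cost `c` cuts the inputs into at most `2 ^ c`
cylinder intersections. One that errs on at most a third of the inputs has correlation at least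
`1/3` with `(-1)^G`, so `1/3 ≤ 2 ^ c * D`, where `D` bounds the correlation of `(-1)^G` with every
cylinder product (`HasRandomizedNOFCost.one_third_le`).

To bound `D`, expand the parity sign on `𝔽_q` in additive characters. As `q` is odd, the trivial
character has coefficient only `1/q`. For the others, `k - 1` Cauchy-Schwarz steps remove the
cylinder factors one by one (`norm_expect_addChar_mul_le`) and bound the `2 ^ (k-1)`-th power of the
correlation by `((k-1)/q) ^ r`. Since `r = 4 * 2 ^ (k-1)`, each correlation is at most `((k-1)/q) ^
4`, small enough to sum over all characters. For `k ^ 2 ≤ q` this gives `D ≤ 2/q`, hence `q ≤ 6 * 2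
^ c`, while `log q` is about `n / 2 ^ (k+1)`. -/

open scoped BigOperators ComplexConjugate

/-! ### Cylinder products. -/

/-- A product of functions of modulus at most one, the `i`-th of which ignores the `i`-th input. -/
def IsCylinderProduct {k : ℕ} {X : Fin k → Type} (g : (∀ i, X i) → ℂ) : Prop :=
  ∃ φ : Fin k → (∀ i, X i) → ℂ, (∀ i x, ‖φ i x‖ ≤ 1) ∧
    (∀ i x a, φ i (Function.update x i a) = φ i x) ∧ ∀ x, g x = ∏ i, φ i x

theorem IsCylinderProduct.one {k : ℕ} {X : Fin k → Type} :
    IsCylinderProduct (fun _ : ∀ i, X i => (1 : ℂ)) :=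
  ⟨fun _ _ => 1, by simp, by simp, by simp⟩

theorem IsCylinderProduct.mul {k : ℕ} {X : Fin k → Type} {g h : (∀ i, X i) → ℂ}
    (hg : IsCylinderProduct g) (hh : IsCylinderProduct h) :
    IsCylinderProduct (fun x => g x * h x) := by
  obtain ⟨φ, h1, h2, h3⟩ := hg
  obtain ⟨χ, k1, k2, k3⟩ := hh
  refine ⟨fun i x => φ i x * χ i x, fun i x => ?_, fun i x a => ?_, fun x => ?_⟩
  · rw [norm_mul]
    exact mul_le_one₀ (h1 i x) (norm_nonneg _) (k1 i x)
  · simp only [h2, k2]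
  · simp only [h3, k3, Finset.prod_mul_distrib]

theorem IsCylinderProduct.conj {k : ℕ} {X : Fin k → Type} {g : (∀ i, X i) → ℂ}
    (hg : IsCylinderProduct g) : IsCylinderProduct (fun x => conj (g x)) := by
  obtain ⟨φ, h1, h2, h3⟩ := hg
  refine ⟨fun i x => conj (φ i x), fun i x => ?_, fun i x a => ?_, fun x => ?_⟩
  · rw [RCLike.norm_conj]
    exact h1 i x
  · simp only [h2]
  · simp only [h3, map_prod]

/-- A function of modulus at most one that ignores one of the inputs is a cylinder product. -/
theorem IsCylinderProduct.of_ignores {k : ℕ} {X : Fin k → Type} {g : (∀ i, X i) → ℂ} (i : Fin k)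
    (hg : ∀ x, ‖g x‖ ≤ 1) (hi : ∀ x a, g (Function.update x i a) = g x) :
    IsCylinderProduct g := by
  refine ⟨fun j x => if j = i then g x else 1, fun j x => ?_, fun j x a => ?_, fun x => ?_⟩
  · dsimp only
    split_ifs
    · exact hg x
    · simp
  · dsimp only
    split_ifs with h
    · subst h
      exact hi x a
    · rfl
  · simp

/-- Splitting off the first input of a cylinder product. -/
theorem IsCylinderProduct.split_cons {m : ℕ} {α : Type} [Nonempty α]
    {g : (Fin (m + 1) → α) → ℂ} (hg : IsCylinderProduct g) :
    ∃ (u : (Fin m → α) → ℂ) (h : α → (Fin m → α) → ℂ), (∀ x, ‖u x‖ ≤ 1) ∧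
      (∀ y, IsCylinderProduct (h y)) ∧ ∀ y x, g (Fin.cons y x) = u x * h y x := by
  obtain ⟨φ, h1, h2, h3⟩ := hg
  obtain ⟨a⟩ := ‹Nonempty α›
  -- The factor `φ 0` ignores the first input, which may therefore be frozen at any `a`.
  refine ⟨fun x => φ 0 (Fin.cons a x), fun y x => ∏ i : Fin m, φ i.succ (Fin.cons y x),
    fun x => h1 _ _, fun y => ⟨fun i x => φ i.succ (Fin.cons y x), fun i x => h1 _ _,
      fun i x b => ?_, fun x => rfl⟩, fun y x => ?_⟩
  · dsimp only
    rw [Fin.cons_update, h2]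
  · rw [h3, Fin.prod_univ_succ]
    have := h2 0 (Fin.cons y x) a
    rw [Fin.update_cons_zero] at this
    dsimp only
    rw [this]

/-! ### Averages and the Cauchy-Schwarz step. -/

theorem sq_expect_le_expect_sq {ι : Type*} [Fintype ι] [Nonempty ι] (f : ι → ℝ) :
    (𝔼 i, f i) ^ 2 ≤ 𝔼 i, f i ^ 2 := by
  simpa using Finset.expect_mul_sq_le_sq_mul_sq Finset.univ f (fun _ => 1)

theorem expect_pow_two_pow_le {ι : Type*} [Fintype ι] [Nonempty ι] (f : ι → ℝ)
    (hf : ∀ i, 0 ≤ f i) (m : ℕ) : (𝔼 i, f i) ^ 2 ^ m ≤ 𝔼 i, f i ^ 2 ^ m := by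
  induction m with
  | zero => simp
  | succ m ih =>
    simp only [pow_succ 2 m, pow_mul]
    exact (pow_le_pow_left₀ (pow_nonneg (Finset.expect_nonneg fun i _ => hf i) _) ih 2).trans
      (sq_expect_le_expect_sq _)

theorem expect_fin_cons {m : ℕ} {α : Type} [Fintype α] (F : (Fin (m + 1) → α) → ℂ) :
    𝔼 x, F x = 𝔼 x : Fin m → α, 𝔼 y : α, F (Fin.cons y x) := by
  rw [Finset.expect_comm, ← Finset.expect_product', Finset.univ_product_univ]
  exact (Fintype.expect_equiv (Fin.consEquiv fun _ => α) _ _ fun _ => rfl).symm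

/-- One Cauchy-Schwarz step: the first input is doubled. -/
theorem norm_expect_mul_sq_le {m : ℕ} {α : Type} [Fintype α] [Nonempty α]
    (F : (Fin (m + 1) → α) → ℂ) (u : (Fin m → α) → ℂ) (h : α → (Fin m → α) → ℂ)
    (hu : ∀ x, ‖u x‖ ≤ 1) :
    ‖𝔼 x : Fin m → α, 𝔼 y : α, F (Fin.cons y x) * (u x * h y x)‖ ^ 2 ≤
      𝔼 y : α, 𝔼 z : α, ‖𝔼 x : Fin m → α,
        (F (Fin.cons y x) * conj (F (Fin.cons z x))) * (h y x * conj (h z x))‖ := by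
  set H : (Fin m → α) → ℂ := fun x => 𝔼 y : α, F (Fin.cons y x) * h y x with hH
  have h1 : ‖𝔼 x : Fin m → α, 𝔼 y : α, F (Fin.cons y x) * (u x * h y x)‖ ≤ 𝔼 x, ‖H x‖ := by
    refine (RCLike.norm_expect_le (K := ℂ)).trans (Finset.expect_le_expect fun x _ => ?_)
    have : 𝔼 y : α, F (Fin.cons y x) * (u x * h y x) = u x * H x := by
      rw [hH, Finset.mul_expect]
      exact Finset.expect_congr rfl fun y _ => by ring
    rw [this, norm_mul]
    exact mul_le_of_le_one_left (norm_nonneg _) (hu x)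
  have h2 : ((𝔼 x, ‖H x‖ ^ 2 : ℝ) : ℂ) = 𝔼 y : α, 𝔼 z : α, 𝔼 x : Fin m → α,
        (F (Fin.cons y x) * conj (F (Fin.cons z x))) * (h y x * conj (h z x)) := by
    have h3 : ∀ x, ((‖H x‖ ^ 2 : ℝ) : ℂ) = 𝔼 y : α, 𝔼 z : α,
        (F (Fin.cons y x) * conj (F (Fin.cons z x))) * (h y x * conj (h z x)) := by
      intro x
      have h4 : conj (H x) = 𝔼 z : α, conj (F (Fin.cons z x)) * conj (h z x) := by
        rw [hH]
        simp only [Fintype.expect_eq_sum_div_card, map_div₀, map_sum, map_mul, map_natCast]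
      push_cast
      rw [← Complex.mul_conj', h4, hH, Finset.expect_mul_expect]
      exact Finset.expect_congr rfl fun y _ => Finset.expect_congr rfl fun z _ => by ring
    rw [Complex.ofReal_expect]
    simp only [h3]
    rw [Finset.expect_comm]
    exact Finset.expect_congr rfl fun y _ => Finset.expect_comm _ _ _
  calc _ ≤ (𝔼 x, ‖H x‖) ^ 2 := pow_le_pow_left₀ (norm_nonneg _) h1 2
    _ ≤ 𝔼 x, ‖H x‖ ^ 2 := sq_expect_le_expect_sq _
    _ = ‖((𝔼 x, ‖H x‖ ^ 2 : ℝ) : ℂ)‖ := by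
      rw [Complex.norm_real, Real.norm_of_nonneg]
      exact Finset.expect_nonneg fun x _ => by positivity
    _ ≤ _ := by
      rw [h2]
      refine (RCLike.norm_expect_le (K := ℂ)).trans (Finset.expect_le_expect fun y _ => ?_)
      exact RCLike.norm_expect_le (K := ℂ)

/-! ### Character sums of weighted generalized inner products. -/

/-- The bias of a multilinear monomial with coefficient `t` in `m + 1` variables, up to rounding. -/
noncomputable def monomialBias (q m : ℕ) (t : ZMod q) : ℝ :=
  if t = 0 then 1 else (m : ℝ) / q

theorem monomialBias_nonneg (q m : ℕ) (t : ZMod q) : 0 ≤ monomialBias q m t := by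
  unfold monomialBias
  split_ifs <;> positivity

/-- For `t ≠ 0` the product `t * z` vanishes only at `z = 0`; this event of probability `1/q`
accounts for the growth from `m/q` to `(m+1)/q`. -/
theorem expect_monomialBias_le (q m : ℕ) [Fact q.Prime] (t : ZMod q) :
    𝔼 z : ZMod q, monomialBias q m (t * z) ≤ monomialBias q (m + 1) t := by
  have hq : (0 : ℝ) < q := by exact_mod_cast (Fact.out : q.Prime).pos
  by_cases ht : t = 0
  · simp [monomialBias, ht]
  · have h1 : ∀ z : ZMod q, monomialBias q m (t * z) ≤ (if z = 0 then 1 else 0) + (m : ℝ) / q := by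
      intro z
      have : (0 : ℝ) ≤ m / q := by positivity
      by_cases hz : z = 0
      · simp [monomialBias, hz, this]
      · simp [monomialBias, hz, ht]
    refine (Finset.expect_le_expect fun z _ => h1 z).trans ?_
    rw [Finset.expect_add_distrib, Fintype.expect_const, Fintype.expect_eq_sum_div_card]
    simp only [Finset.sum_ite_eq', Finset.mem_univ, if_true, ZMod.card, monomialBias, ht, if_false]
    push_cast
    apply le_of_eq
    ring

theorem expect_pi_prod {r : ℕ} {α : Type} [Fintype α] (f : Fin r → α → ℝ) :
    𝔼 z : Fin r → α, ∏ j, f j (z j) = ∏ j, 𝔼 a, f j a := by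
  simp only [Fintype.expect_eq_sum_div_card, Finset.prod_div_distrib]
  rw [← Fintype.prod_sum]
  simp

theorem AddChar.map_finset_sum {ι A M : Type*} [AddCommMonoid A] [CommMonoid M] (ψ : AddChar A M)
    (s : Finset ι) (f : ι → A) : ψ (∑ j ∈ s, f j) = ∏ j ∈ s, ψ (f j) := by
  classical
  induction s using Finset.induction_on with
  | empty => simp
  | insert a s ha ih => rw [Finset.sum_insert ha, Finset.prod_insert ha, ψ.map_add_eq_mul, ih]

/-- The average factors over the coordinates, and each factor is `0` or `1` by orthogonality of
characters. -/
theorem expect_addChar_linear (q r : ℕ) [Fact q.Prime] (ψ : AddChar (ZMod q) ℂ)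
    (hψ : ψ.IsPrimitive) (c : Fin r → ZMod q) :
    ‖𝔼 y : Fin r → ZMod q, ψ (∑ j, c j * y j)‖ ≤ ∏ j, monomialBias q 0 (c j) := by
  have h1 : ∀ y : Fin r → ZMod q, ψ (∑ j, c j * y j) = ∏ j, ψ (c j * y j) := fun y =>
    AddChar.map_finset_sum ψ _ _
  simp only [h1, Fintype.expect_eq_sum_div_card]
  rw [← Fintype.prod_sum (fun j a => ψ (c j * a))]
  have h2 : ∀ j, ∑ a, ψ (c j * a) = (q : ℂ) * (monomialBias q 0 (c j) : ℂ) := by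
    intro j
    have := AddChar.sum_mulShift (c j) hψ
    simp only [ZMod.card, mul_comm _ (c j)] at this
    rw [this]
    unfold monomialBias
    split_ifs <;> simp
  simp only [h2, Finset.prod_mul_distrib]
  have hq : (q : ℂ) ≠ 0 := by exact_mod_cast (Fact.out : q.Prime).ne_zero
  rw [Fintype.card_fun, ZMod.card, Fintype.card_fin]
  simp only [Finset.prod_const, Finset.card_univ, Fintype.card_fin, Nat.cast_pow]
  rw [mul_div_cancel_left₀ _ (pow_ne_zero _ hq), norm_prod]
  refine le_of_eq (Finset.prod_congr rfl fun j _ => ?_)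
  rw [Complex.norm_real, Real.norm_of_nonneg (monomialBias_nonneg _ _ _)]

/-- The correlation of a character of a weighted generalized inner product with a cylinder
product. -/
theorem norm_expect_addChar_mul_le (q r : ℕ) [Fact q.Prime] (ψ : AddChar (ZMod q) ℂ)
    (hψ : ψ.IsPrimitive) (m : ℕ) : ∀ (c : Fin r → ZMod q)
    (g : (Fin (m + 1) → Fin r → ZMod q) → ℂ), IsCylinderProduct g →
    ‖𝔼 x, ψ (∑ j, c j * ∏ i, x i j) * g x‖ ^ 2 ^ m ≤ ∏ j, monomialBias q m (c j) := by
  induction m with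
  | zero =>
    intro c g hg
    obtain ⟨u, h, hu, hh, hgu⟩ := hg.split_cons
    rw [expect_fin_cons]
    simp only [hgu, Fin.prod_univ_succ, Fin.cons_zero, Finset.univ_eq_empty, Finset.prod_empty,
      mul_one, pow_zero, pow_one]
    have h0 : ∀ y x, h y x = 1 := fun y x => by
      obtain ⟨φ, -, -, h3⟩ := hh y
      rw [h3]
      simp
    simp only [h0, mul_one, ← Finset.expect_mul, ← Finset.mul_expect]
    rw [norm_mul]
    refine (mul_le_of_le_one_right (norm_nonneg _) ?_).trans (expect_addChar_linear q r ψ hψ c)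
    exact (RCLike.norm_expect_le (K := ℂ)).trans
      (Finset.expect_le Finset.univ_nonempty fun x _ => hu x)
  | succ m ih =>
    intro c g hg
    obtain ⟨u, h, hu, hh, hgu⟩ := hg.split_cons
    -- The phase is linear in the first input, so doubling that input leaves a phase of the same
    -- shape in one input fewer, with new coefficients. Hence the induction over arbitrary `c`.
    have h1 : ∀ y z : Fin r → ZMod q, ∀ x : Fin (m + 1) → Fin r → ZMod q,
        ψ (∑ j, c j * ∏ i, (Fin.cons y x : Fin (m + 2) → Fin r → ZMod q) i j) *
          conj (ψ (∑ j, c j * ∏ i, (Fin.cons z x : Fin (m + 2) → Fin r → ZMod q) i j)) =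
        ψ (∑ j, (c j * (y j - z j)) * ∏ i, x i j) := by
      intro y z x
      rw [← AddChar.map_neg_eq_conj, ← AddChar.map_add_eq_mul, ← sub_eq_add_neg,
        ← Finset.sum_sub_distrib]
      congr 1
      refine Finset.sum_congr rfl fun j _ => ?_
      rw [Fin.prod_univ_succ (n := m + 1), Fin.prod_univ_succ (n := m + 1)]
      simp only [Fin.cons_zero, Fin.cons_succ]
      ring
    have h2 := norm_expect_mul_sq_le
      (fun x : Fin (m + 2) → Fin r → ZMod q => ψ (∑ j, c j * ∏ i, x i j)) u h hu
    simp only [h1] at h2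
    rw [expect_fin_cons]
    simp only [hgu]
    rw [pow_succ', pow_mul]
    refine (pow_le_pow_left₀ (by positivity) h2 _).trans ?_
    refine (expect_pow_two_pow_le _
      (fun y => Finset.expect_nonneg fun z _ => norm_nonneg _) m).trans ?_
    have h3 : ∀ y : Fin r → ZMod q, (𝔼 z : Fin r → ZMod q,
        ‖𝔼 x : Fin (m + 1) → Fin r → ZMod q, ψ (∑ j, (c j * (y j - z j)) * ∏ i, x i j) *
          (h y x * conj (h z x))‖) ^ 2 ^ m ≤ ∏ j, monomialBias q (m + 1) (c j) := by
      intro y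
      refine (expect_pow_two_pow_le _ (fun z => norm_nonneg _) m).trans ?_
      refine (Finset.expect_le_expect fun z _ =>
        ih (fun j => c j * (y j - z j)) _ ((hh y).mul (hh z).conj)).trans ?_
      -- For fixed `y` the difference `y - z` is uniform, so the coordinates average independently.
      rw [Fintype.expect_equiv (Equiv.subLeft y)
        (fun z : Fin r → ZMod q => ∏ j, monomialBias q m (c j * (y j - z j)))
        (fun z : Fin r → ZMod q => ∏ j, monomialBias q m (c j * z j)) (fun z => rfl),
        expect_pi_prod (fun j a => monomialBias q m (c j * a))]
      exact Finset.prod_le_prod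
        (fun j _ => Finset.expect_nonneg fun a _ => monomialBias_nonneg _ _ _)
        fun j _ => expect_monomialBias_le q m (c j)
    exact Finset.expect_le Finset.univ_nonempty fun y _ => h3 y

/-! ### From protocols to discrepancy. -/

/-- The sign `(-1) ^ b` of a bit. -/
def boolSign (b : Bool) : ℂ := if b then -1 else 1

theorem norm_boolSign (b : Bool) : ‖boolSign b‖ = 1 := by
  cases b <;> simp [boolSign]

/-- A function that correlates little with cylinder products correlates little with protocols. -/
theorem norm_expect_mul_boolSign_eval_le {k : ℕ} {X : Fin k → Type} [∀ i, Fintype (X i)]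
    (f : (∀ i, X i) → ℂ) (D : ℝ)
    (hD : ∀ g, IsCylinderProduct g → ‖𝔼 x, f x * g x‖ ≤ D) (P : NOFProtocol X) :
    ∀ g, IsCylinderProduct g → ‖𝔼 x, f x * (g x * boolSign (P.eval x))‖ ≤ 2 ^ P.cost * D := by
  have hD0 : 0 ≤ D := (norm_nonneg _).trans (hD _ IsCylinderProduct.one)
  induction P with
  | leaf out =>
    intro g hg
    have : 𝔼 x, f x * (g x * boolSign ((NOFProtocol.leaf out).eval x)) =
        (𝔼 x, f x * g x) * boolSign out := by
      rw [Finset.expect_mul]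
      exact Finset.expect_congr rfl fun x _ => by simp only [NOFProtocol.eval]; ring
    rw [this, norm_mul, norm_boolSign, mul_one]
    simpa [NOFProtocol.cost] using hD g hg
  | node i bit F T ihF ihT =>
    intro g hg
    -- The indicator of the written bit ignores input `i` and can be absorbed into `g`, which is why
    -- the induction runs over all `g`; each level of the tree costs a factor `2`.
    have hbit : ∀ c : Bool, IsCylinderProduct (fun x : ∀ i, X i =>
        if bit (fun j : {j : Fin k // j ≠ i} => x j) = c then (1 : ℂ) else 0) := fun c => by
      refine IsCylinderProduct.of_ignores i (fun x => ?_) (fun x a => ?_)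
      · split_ifs <;> simp
      · have : (fun j : {j : Fin k // j ≠ i} => Function.update x i a j) =
            fun j : {j : Fin k // j ≠ i} => x j := by
          funext j
          exact Function.update_of_ne j.2 _ _
        simp only [this]
    have key : 𝔼 x, f x * (g x * boolSign ((NOFProtocol.node i bit F T).eval x)) =
        (𝔼 x, f x * ((g x * if bit (fun j : {j : Fin k // j ≠ i} => x j) = true then (1 : ℂ) else 0) *
          boolSign (T.eval x))) +
        𝔼 x, f x * ((g x * if bit (fun j : {j : Fin k // j ≠ i} => x j) = false then (1 : ℂ) else 0) *
          boolSign (F.eval x)) := by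
      rw [← Finset.expect_add_distrib]
      refine Finset.expect_congr rfl fun x _ => ?_
      simp only [NOFProtocol.eval]
      cases bit (fun j : {j : Fin k // j ≠ i} => x j) <;> simp
    rw [key]
    have hT := ihT _ (hg.mul (hbit true))
    have hF := ihF _ (hg.mul (hbit false))
    have h1 : (2 : ℝ) ^ T.cost * D ≤ 2 ^ max F.cost T.cost * D :=
      mul_le_mul_of_nonneg_right (pow_le_pow_right₀ one_le_two (le_max_right _ _)) hD0
    have h2 : (2 : ℝ) ^ F.cost * D ≤ 2 ^ max F.cost T.cost * D :=
      mul_le_mul_of_nonneg_right (pow_le_pow_right₀ one_le_two (le_max_left _ _)) hD0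
    simp only [NOFProtocol.cost, pow_succ]
    refine (norm_add_le _ _).trans ?_
    linarith

/-- Some deterministic protocol errs on at most a third of the inputs. -/
theorem HasRandomizedNOFCost.exists_protocol {k : ℕ} {X : Fin k → Type} [∀ i, Fintype (X i)]
    {f : (∀ i, X i) → Bool} {c : ℕ} (h : HasRandomizedNOFCost f c) :
    ∃ P : NOFProtocol X, P.cost ≤ c ∧
      3 * (Finset.univ.filter fun x => P.eval x ≠ f x).card ≤ Fintype.card (∀ i, X i) := by
  classical
  obtain ⟨μ, hc, he⟩ := h
  by_contra hcon
  push Not at hcon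
  set N := Fintype.card (∀ i, X i) with hN
  have h1 : ∑ x : ∀ i, X i, μ.toOuterMeasure {P | P.eval x ≠ f x} ≤ N * (1 / 3 : ℝ≥0∞) := by
    refine (Finset.sum_le_sum fun x _ => he x).trans ?_
    rw [Finset.sum_const, Finset.card_univ, nsmul_eq_mul]
  have h2 : ∑ x : ∀ i, X i, μ.toOuterMeasure {P | P.eval x ≠ f x} =
      ∑' P, μ P * ((Finset.univ.filter fun x => P.eval x ≠ f x).card : ℝ≥0∞) := by
    simp only [PMF.toOuterMeasure_apply]
    rw [← Summable.tsum_finsetSum fun _ _ => ENNReal.summable]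
    refine tsum_congr fun P => ?_
    simp only [Set.indicator_apply, Set.mem_ofPred_eq]
    rw [← Finset.sum_filter, Finset.sum_const, nsmul_eq_mul, mul_comm]
  -- More than `N/3` errors means at least `⌊N/3⌋ + 1`; the integer form keeps the inequality strict
  -- after averaging over `μ`.
  have h3 : ((N / 3 + 1 : ℕ) : ℝ≥0∞) ≤
      ∑' P, μ P * ((Finset.univ.filter fun x => P.eval x ≠ f x).card : ℝ≥0∞) := by
    calc ((N / 3 + 1 : ℕ) : ℝ≥0∞) = ∑' P, μ P * ((N / 3 + 1 : ℕ) : ℝ≥0∞) := by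
          rw [ENNReal.tsum_mul_right, μ.tsum_coe, one_mul]
      _ ≤ _ := by
          refine ENNReal.tsum_le_tsum fun P => ?_
          by_cases hP : P ∈ μ.support
          · have := hcon P (hc P hP)
            gcongr
            omega
          · rw [PMF.mem_support_iff, not_not] at hP
            simp [hP]
  have h4 := (h2 ▸ h3).trans h1
  have h5 : (((N / 3 + 1 : ℕ) : ℝ≥0∞)) * 3 ≤ N := by
    calc _ ≤ (N * (1 / 3 : ℝ≥0∞)) * 3 := by gcongr
      _ = N := by
        rw [mul_assoc, ENNReal.div_mul_cancel (by norm_num) (by norm_num), mul_one]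
  have h6 : (N / 3 + 1) * 3 ≤ N := by exact_mod_cast h5
  omega

/-- The discrepancy bound for randomized protocols. -/
theorem HasRandomizedNOFCost.one_third_le {k : ℕ} {X : Fin k → Type} [∀ i, Fintype (X i)]
    [∀ i, Nonempty (X i)] {f : (∀ i, X i) → Bool} {c : ℕ} (h : HasRandomizedNOFCost f c) (D : ℝ)
    (hD : ∀ g, IsCylinderProduct g → ‖𝔼 x, boolSign (f x) * g x‖ ≤ D) :
    1 / 3 ≤ 2 ^ c * D := by
  classical
  obtain ⟨P, hPc, hP⟩ := h.exists_protocol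
  have hD0 : 0 ≤ D := (norm_nonneg _).trans (hD _ IsCylinderProduct.one)
  have h1 := norm_expect_mul_boolSign_eval_le (fun x => boolSign (f x)) D hD P _
    IsCylinderProduct.one
  set N := Fintype.card (∀ i, X i) with hN
  set e := (Finset.univ.filter fun x => P.eval x ≠ f x).card with he
  have hNpos : (0 : ℝ) < N := by exact_mod_cast Fintype.card_pos
  have h2 : 𝔼 x, boolSign (f x) * (1 * boolSign (P.eval x)) =
      (((N : ℝ) - 2 * e) / N : ℝ) := by
    rw [Fintype.expect_eq_sum_div_card]
    have : ∀ x, boolSign (f x) * (1 * boolSign (P.eval x)) =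
        1 - 2 * if P.eval x ≠ f x then (1 : ℂ) else 0 := by
      intro x
      cases f x <;> cases P.eval x <;> norm_num [boolSign]
    simp only [this]
    rw [Finset.sum_sub_distrib, ← Finset.mul_sum, ← Finset.sum_filter]
    simp only [Finset.sum_const, Finset.card_univ, nsmul_eq_mul, mul_one, ← he, ← hN]
    push_cast
    rfl
  rw [h2, Complex.norm_real] at h1
  have h3 : (3 * e : ℝ) ≤ N := by exact_mod_cast hP
  calc (1 / 3 : ℝ) ≤ ((N : ℝ) - 2 * e) / N := by
        rw [div_le_div_iff₀ (by norm_num) hNpos]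
        linarith
    _ ≤ ‖((N : ℝ) - 2 * e) / N‖ := Real.le_norm_self _
    _ ≤ 2 ^ P.cost * D := h1
    _ ≤ 2 ^ c * D := by gcongr; norm_num

/-! ### Fourier expansion of the parity. -/

/-- The sum of `(-1) ^ z` over the residues `z` modulo an odd number. -/
theorem sum_boolSign_val {q : ℕ} [NeZero q] (hq : Odd q) :
    ∑ z : ZMod q, boolSign (decide (z.val % 2 = 1)) = 1 := by
  have h : ∀ n : ℕ, boolSign (decide (n % 2 = 1)) = (-1) ^ n := by
    intro n
    rcases Nat.even_or_odd n with hn | hn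
    · simp [boolSign, hn.neg_one_pow, Nat.even_iff.mp hn]
    · simp [boolSign, hn.neg_one_pow, Nat.odd_iff.mp hn]
  simp only [h]
  obtain ⟨m, rfl⟩ : ∃ m, q = m + 1 := ⟨q - 1, by have := NeZero.pos q; omega⟩
  change ∑ z : Fin (m + 1), (-1 : ℂ) ^ (z : ℕ) = 1
  rw [Fin.sum_univ_eq_sum_range (fun i => (-1 : ℂ) ^ i), neg_one_geom_sum, if_neg]
  exact Nat.not_even_iff_odd.mpr hq

/-- The discrepancy of the parity of the generalized inner product. -/
theorem norm_expect_boolSign_GIPMod2_mul_le (q m r : ℕ) [Fact q.Prime] (hq : Odd q)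
    (hr : r = 4 * 2 ^ m) (g : (Fin (m + 1) → Fin r → ZMod q) → ℂ) (hg : IsCylinderProduct g) :
    ‖𝔼 x, boolSign (GIPMod2 q r (m + 1) x) * g x‖ ≤
      1 / q + (m : ℝ) ^ 4 / q ^ 3 := by
  have hq0 : (0 : ℝ) < q := by exact_mod_cast (Fact.out : q.Prime).pos
  set Φ : ZMod q → ℂ := fun z => boolSign (decide (z.val % 2 = 1)) with hΦ
  have hinv : ∀ z, Φ z = (q : ℂ)⁻¹ * ∑ a, ZMod.stdAddChar (a * z) * ZMod.dft Φ a := by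
    intro z
    have := ZMod.invDFT_apply (ZMod.dft Φ) z
    rw [LinearEquiv.symm_apply_apply] at this
    simpa using this
  have hdft : ∀ a, ‖ZMod.dft Φ a‖ ≤ q := by
    intro a
    rw [ZMod.dft_apply]
    refine (norm_sum_le _ _).trans ?_
    refine (Finset.sum_le_sum (g := fun _ => (1 : ℝ)) fun z _ => ?_).trans ?_
    · rw [norm_smul, AddChar.norm_apply, hΦ, norm_boolSign, one_mul]
    · simp [ZMod.card]
  have hdft0 : ZMod.dft Φ 0 = 1 := by
    rw [ZMod.dft_apply_zero]
    exact sum_boolSign_val hq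
  set S : ZMod q → ℂ := fun a => 𝔼 x : Fin (m + 1) → Fin r → ZMod q,
    ZMod.stdAddChar (a * GIP q r (m + 1) x) * g x with hS
  have hexp : 𝔼 x, boolSign (GIPMod2 q r (m + 1) x) * g x =
      (q : ℂ)⁻¹ * ∑ a, ZMod.dft Φ a * S a := by
    have : ∀ x, boolSign (GIPMod2 q r (m + 1) x) * g x = (q : ℂ)⁻¹ * ∑ a, ZMod.dft Φ a *
        (ZMod.stdAddChar (a * GIP q r (m + 1) x) * g x) := by
      intro x
      have h1 : boolSign (GIPMod2 q r (m + 1) x) = Φ (GIP q r (m + 1) x) := rfl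
      rw [h1, hinv, mul_assoc, Finset.sum_mul]
      congr 1
      exact Finset.sum_congr rfl fun a _ => by ring
    simp only [this]
    rw [← Finset.mul_expect, Finset.expect_sum_comm]
    simp only [hS, Finset.mul_expect]
  have hS0 : ‖S 0‖ ≤ 1 := by
    refine (RCLike.norm_expect_le (K := ℂ)).trans
      (Finset.expect_le Finset.univ_nonempty fun x _ => ?_)
    obtain ⟨φ, h1, -, h3⟩ := hg
    rw [norm_mul, AddChar.norm_apply, one_mul, h3, norm_prod]
    exact Finset.prod_le_one (fun i _ => norm_nonneg _) fun i _ => h1 i x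
  have hSa : ∀ a, a ≠ 0 → ‖S a‖ ≤ ((m : ℝ) / q) ^ 4 := by
    intro a ha
    have h1 := norm_expect_addChar_mul_le q r ZMod.stdAddChar
      (ZMod.isPrimitive_stdAddChar q) m (fun _ => a) g hg
    simp only [← Finset.mul_sum, monomialBias, ha, if_false, Finset.prod_const, Finset.card_univ,
      Fintype.card_fin] at h1
    -- The exponent `4` that survives the `2 ^ m`-th root outweighs the loss of a factor `q` from
    -- summing over all characters and leaves `m ^ 4 / q ^ 3`.
    have h2 : ((m : ℝ) / q) ^ r = (((m : ℝ) / q) ^ 4) ^ 2 ^ m := by rw [hr, pow_mul]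
    rw [h2] at h1
    exact le_of_pow_le_pow_left₀ (by positivity) (by positivity) h1
  have hterm : ∀ a, ‖ZMod.dft Φ a * S a‖ ≤ (if a = 0 then 1 else 0) + q * ((m : ℝ) / q) ^ 4 := by
    intro a
    rw [norm_mul]
    by_cases ha : a = 0
    · subst ha
      rw [hdft0, norm_one, one_mul, if_pos rfl]
      have : (0 : ℝ) ≤ q * ((m : ℝ) / q) ^ 4 := by positivity
      linarith
    · rw [if_neg ha, zero_add]
      exact mul_le_mul (hdft a) (hSa a ha) (norm_nonneg _) hq0.le
  rw [hexp, norm_mul, norm_inv, Complex.norm_natCast]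
  calc (q : ℝ)⁻¹ * ‖∑ a, ZMod.dft Φ a * S a‖
      ≤ (q : ℝ)⁻¹ * ∑ a : ZMod q, ((if a = 0 then 1 else 0) + q * ((m : ℝ) / q) ^ 4) := by
        gcongr
        exact (norm_sum_le _ _).trans (Finset.sum_le_sum fun a _ => hterm a)
    _ = 1 / q + (m : ℝ) ^ 4 / q ^ 3 := by
        rw [Finset.sum_add_distrib]
        simp only [Finset.sum_ite_eq', Finset.mem_univ, if_true, Finset.sum_const,
          Finset.card_univ, ZMod.card, nsmul_eq_mul]
        field_simp

/-! ### Numerical bounds and the conclusion. -/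

/-- The communication lower bound, in the range `k ^ 2 ≤ q`. -/
theorem HasRandomizedNOFCost.le_two_pow_of_GIPMod2 {q k c : ℕ} (hq : q.Prime) (hodd : Odd q)
    (hk : 0 < k) (hkq : k ^ 2 ≤ q)
    (h : HasRandomizedNOFCost (GIPMod2 q (2 ^ (k + 1)) k) c) : q ≤ 6 * 2 ^ c := by
  have : Fact q.Prime := ⟨hq⟩
  obtain ⟨m, rfl⟩ : ∃ m, k = m + 1 := ⟨k - 1, by omega⟩
  have h1 := h.one_third_le _ (norm_expect_boolSign_GIPMod2_mul_le q m _ hodd (by ring))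
  have hq0 : (0 : ℝ) < q := by exact_mod_cast hq.pos
  have h2 : (m : ℝ) ^ 2 ≤ q := by
    have : m ^ 2 ≤ q := (Nat.pow_le_pow_left (Nat.le_succ m) 2).trans hkq
    exact_mod_cast this
  have h3 : (m : ℝ) ^ 4 / q ^ 3 ≤ 1 / q := by
    rw [div_le_div_iff₀ (by positivity) hq0]
    have : (m : ℝ) ^ 4 ≤ q ^ 2 := by nlinarith [sq_nonneg (m : ℝ)]
    nlinarith
  have h4 : (1 / 3 : ℝ) ≤ 2 ^ c * (2 / q) := h1.trans (by
    gcongr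
    calc _ ≤ 1 / (q : ℝ) + 1 / q := by gcongr
      _ = 2 / q := by ring)
  rw [← mul_div_assoc, div_le_div_iff₀ (by norm_num) hq0] at h4
  have : (q : ℝ) ≤ 6 * 2 ^ c := by linarith
  exact_mod_cast this

/-- The number of bits of an odd prime is the number of bits that distinguish the residues. -/
theorem clog_two_eq_size {q : ℕ} (h : 1 < q) (hodd : Odd q) : Nat.clog 2 q = Nat.size q := by
  have hs : 1 < Nat.size q := Nat.lt_size.mpr (by omega)
  refine le_antisymm ((Nat.clog_le_iff_le_pow one_lt_two).mpr (Nat.lt_size_self q).le) ?_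
  -- The two quantities could differ only if `q` were a power of two.
  by_contra hlt
  have h1 : Nat.clog 2 q ≤ Nat.size q - 1 := by omega
  rw [Nat.clog_le_iff_le_pow one_lt_two] at h1
  have h2 : 2 ^ (Nat.size q - 1) ≤ q := Nat.lt_size.mp (by omega)
  have h3 : q = 2 ^ (Nat.size q - 1) := le_antisymm h1 h2
  rw [h3] at hodd
  exact Nat.not_even_iff_odd.mpr hodd ((Nat.even_pow' (by omega)).mpr even_two)

/-- The consequences of the restriction on the number of players. -/
theorem bounds_of_le_logb {n k b : ℕ}
    (h : (k : ℝ) ≤ Real.logb 2 n - 5 * Real.logb 2 (Real.logb 2 n))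
    (hk : 0 < k) (hb : b = n / 2 ^ (k + 1)) (hb2 : 2 ≤ b) : 100 ≤ b ∧ k ^ 2 ≤ b - 1 := by
  -- `b ≥ 2` excludes the small `n` at which the iterated logarithm degenerates, and gives `L ≥ 3`.
  have hn : 8 ≤ n := by
    have h1 : 2 * 2 ^ (k + 1) ≤ n := by
      rw [hb] at hb2
      exact (Nat.le_div_iff_mul_le (by positivity)).mp hb2
    have h2 : 2 ^ 2 ≤ 2 ^ (k + 1) := Nat.pow_le_pow_right two_pos (by omega)
    omega
  have hnR : (8 : ℝ) ≤ n := by exact_mod_cast hn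
  set L := Real.logb 2 n with hL
  have hL3 : 3 ≤ L := by
    rw [hL, Real.le_logb_iff_rpow_le one_lt_two (by linarith)]
    norm_num
    exact hn
  have hLL : 0 ≤ Real.logb 2 L := Real.logb_nonneg one_lt_two (by linarith)
  have hkL : (k : ℝ) ≤ L := by linarith
  -- The hypothesis exponentiated. With `n < 2 ^ (k+1) * (b+1)` it yields `L ^ 5 < 2 * (b+1)`, so
  -- `b` far exceeds `L ^ 2 ≥ k ^ 2`.
  have h1 : (2 : ℝ) ^ k * L ^ 5 ≤ n := by
    have h2 : (2 : ℝ) ^ ((k : ℝ) + 5 * Real.logb 2 L) = 2 ^ k * L ^ 5 := by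
      rw [Real.rpow_add two_pos, Real.rpow_natCast, mul_comm 5, Real.rpow_mul two_pos.le,
        Real.rpow_logb two_pos (by norm_num) (by linarith)]
      norm_cast
    have h3 : (2 : ℝ) ^ L = n := Real.rpow_logb two_pos (by norm_num) (by linarith)
    rw [← h2, ← h3]
    exact Real.rpow_le_rpow_of_exponent_le one_le_two (by linarith)
  have h4 : (n : ℝ) < 2 ^ (k + 1) * (b + 1) := by
    have : n < 2 ^ (k + 1) * (b + 1) := by
      rw [hb]
      exact Nat.lt_mul_div_succ n (by positivity)
    exact_mod_cast this
  have h5 : L ^ 5 < 2 * (b + 1) := by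
    have h6 : (2 : ℝ) ^ k * L ^ 5 < 2 ^ k * (2 * (b + 1)) := by
      calc _ ≤ (n : ℝ) := h1
        _ < _ := h4
        _ = _ := by ring
    exact lt_of_mul_lt_mul_left h6 (by positivity)
  have h7 : 27 * L ^ 2 ≤ L ^ 5 := by
    have : (3 : ℝ) ^ 3 ≤ L ^ 3 := pow_le_pow_left₀ (by norm_num) hL3 3
    nlinarith [sq_nonneg L]
  have h8 : (9 : ℝ) ≤ L ^ 2 := by nlinarith
  have h9 : (k : ℝ) ^ 2 ≤ L ^ 2 := pow_le_pow_left₀ (by positivity) hkL 2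
  have hb100 : 100 ≤ b := by
    have : (100 : ℝ) ≤ b := by linarith
    exact_mod_cast this
  refine ⟨hb100, ?_⟩
  have h10 : k ^ 2 + 1 ≤ b := by
    have : (k : ℝ) ^ 2 + 1 ≤ b := by linarith
    exact_mod_cast this
  omega

theorem le_randomizedNOFComplexity {k : ℕ} {X : Fin k → Type} {f : (∀ i, X i) → Bool} {M : ℕ}
    (h : ∀ c, HasRandomizedNOFCost f c → M ≤ c) : (M : ℕ∞) ≤ randomizedNOFComplexity f :=
  le_iInf₂ fun c hc => by exact_mod_cast h c hc

theorem mainTheorem5 :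
    ∃ c : ℝ, 0 < c ∧
      ∀ (n k q : ℕ), 0 < n → 0 < k →
        (k : ℝ) ≤ Real.logb 2 n - 5 * Real.logb 2 (Real.logb 2 n) →
        q.Prime → Nat.size q = n / 2 ^ (k + 1) →
        (GIPInputLength q (2 ^ (k + 1)) ≤ n ∧
          n < GIPInputLength q (2 ^ (k + 1)) + 2 ^ (k + 1) ∧
          (2 ^ (k + 1) ∣ n → GIPInputLength q (2 ^ (k + 1)) = n)) ∧
        ENNReal.ofReal (c * ((n : ℝ) / 2 ^ (k + 1))) ≤
          (randomizedNOFComplexity (GIPMod2 q (2 ^ (k + 1)) k) : ℝ≥0∞) := by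
  -- With `s = Nat.size q`, the cost is at least `s - 4` and `n / 2 ^ (k+1) ≤ s + 1`; since `s ≥
  -- 100`, half of the latter is below the former.
  refine ⟨1 / 2, by norm_num, fun n k q _ hk h hq hs => ?_⟩
  have hb2 : 2 ≤ Nat.size q := Nat.lt_size.mpr (by simpa using hq.two_le)
  obtain ⟨hb, hkb⟩ := bounds_of_le_logb h hk hs hb2
  have hq1 : 2 ^ (Nat.size q - 1) ≤ q := Nat.lt_size.mp (by omega)
  have hkq : k ^ 2 ≤ q := (hkb.trans Nat.lt_two_pow_self.le).trans hq1
  have hodd : Odd q := by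
    refine hq.odd_of_ne_two fun h2 => ?_
    have : Nat.size q ≤ 2 := Nat.size_le.mpr (by rw [h2]; norm_num)
    omega
  have hlen : GIPInputLength q (2 ^ (k + 1)) = 2 ^ (k + 1) * (n / 2 ^ (k + 1)) := by
    rw [GIPInputLength, Nat.card_zmod, clog_two_eq_size hq.one_lt hodd, hs]
  have hlt : n < 2 ^ (k + 1) * (n / 2 ^ (k + 1) + 1) :=
    Nat.lt_mul_div_succ n (by positivity)
  refine ⟨⟨?_, ?_, fun hd => ?_⟩, ?_⟩
  · rw [hlen]
    exact Nat.mul_div_le _ _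
  · rw [hlen, ← Nat.mul_succ]
    exact hlt
  · rw [hlen]
    exact Nat.mul_div_cancel' hd
  · have hM : ((Nat.size q - 4 : ℕ) : ℕ∞) ≤
        randomizedNOFComplexity (GIPMod2 q (2 ^ (k + 1)) k) := by
      refine le_randomizedNOFComplexity fun c hc => ?_
      have h1 := hc.le_two_pow_of_GIPMod2 hq hodd hk hkq
      -- Here `6` is rounded up to `2 ^ 3`.
      have h2 : 2 ^ (Nat.size q - 1) ≤ 2 ^ (c + 3) := by
        rw [pow_add]
        omega
      have := (Nat.pow_le_pow_iff_right one_lt_two).mp h2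
      omega
    refine le_trans ?_ (ENat.toENNReal_le.mpr hM)
    rw [ENat.toENNReal_coe, ← ENNReal.ofReal_natCast]
    apply ENNReal.ofReal_le_ofReal
    have h3 : (n : ℝ) / 2 ^ (k + 1) ≤ Nat.size q + 1 := by
      rw [div_le_iff₀ (by positivity), hs, mul_comm]
      exact_mod_cast hlt.le
    have h4 : (100 : ℝ) ≤ Nat.size q := by exact_mod_cast hb
    rw [Nat.cast_sub (by omega)]
    push_cast
    linarith
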